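/- Let $\mathbb{K}$ be a field of characteristic $0$, and let $(A, d=\Delta_0, \Delta_1, \Delta_2, \ldots)$ be a multicomplex over $\mathbb{K}$: a $\mathbb{Z}$-graded vector space $A$ with linear operators $\Delta_n$ of degree $2n-1$ such that $\sum_{i=0}^n \Delta_i\Delta_{n-i}=0$ for all $n\ge 0$. Put $C_{p,q}:=A_{p-q}$ for $p,q\in\mathbb{Z}$. Let $\widehat{\mathrm{Tot}}_n$ be the space of families $(x_q)_q\in\prod_{p+q=n}C_{p,q}$, with $x_q \in C_{n-q,q}$, such that $x_q=0$ for all sufficiently large $q$ (this is the whole product if $A$ is bounded below), with differential $(\partial x)_q=\sum_{r\ge0}\Delta_r x_{q+r}$. Filter it by rows: $F_s$ consists of the families with $x_q=0$ for $q>-s$. (Thus $F_s$ is in each degree the full product over the rows $q\le -s$.) Let $E^r(A)$ be the spectral sequence of this filtered complex, $$E^r_s=Z^r_s/(Z^{r-1}_{s+1}+\partial Z^{r-1}_{s-r+1}),\qquad Z^r_s=\{x\in F_s:\ \partial x\in F_{s+r}\},$$ with differentials $d^r\colon E^r_s\to E^r_{s+r}$ induced by $\partial$. It degenerates at the first page if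 $d^r=0$ for all $r\ge1$. A homotopy retract of $(A,d)$ onto $(H(A,d),0)$ consists of homogeneous linear maps $p\colon A\to H(A,d)$ and $i\colon H(A,d)\to A$ of degree $0$ and $h\colon A\to A$ of degree $1$, where $p$ is a chain map, $i$ is a quasi-isomorphism and $ip-\mathrm{id}_A=dh+hd$. Its transferred operators are $$\Delta'_n=\sum_{k\ge1}\ \sum_{\substack{i_1,\ldots,i_k\ge1\\ i_1+\cdots+i_k=n}}p\,\Delta_{i_1}h\,\Delta_{i_2}h\cdots h\,\Delta_{i_k}\,i\qquad(n\ge1).$$ Hodge-to-de Rham degeneration data is a homotopy retract of $(A,d)$ onto $(H(A,d),0)$ with $\Delta'_n=0$ for all $n\ge1$. Then the spectral sequence $E^r(A)$ degenerates at the first page if and only if the multicomplex admits Hodge-to-de Rham degeneration data. Moreover, for every homotopy retract of $(A,d)$ onto $(H(A,d),0)$, the spectral sequence degenerates at the first page if and only if the transferred operators $\Delta'_n$ on $H(A,d)$ vanish for all $n\ge1$. -/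

import Mathlib

/-! ### Chain complexes inside a graded vector space, homology, homotopy retracts -/

/-- A linear map `f : A → B` between graded vector spaces is homogeneous of degree `k`. -/
def HasDegree {K A B : Type*} [Field K] [AddCommGroup A] [Module K A] [AddCommGroup B]
    [Module K B] (𝒜 : ℤ → Submodule K A) (ℬ : ℤ → Submodule K B) (f : A →ₗ[K] B) (k : ℤ) :
    Prop :=
  ∀ (j : ℤ) (x : A), x ∈ 𝒜 j → f x ∈ ℬ (j + k)

/-- The homology `ker d / im d` of a square-zero operator `d` (as a vector space). -/
abbrev Homology {K A : Type*} [Field K] [AddCommGroup A] [Module K A] (d : A →ₗ[K] A) : Type _ :=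
  LinearMap.ker d ⧸ (LinearMap.range d).submoduleOf (LinearMap.ker d)

/-- The induced grading on homology: the degree `j` part consists of the classes of the cycles
of degree `j`. -/
def homologyGrading {K A : Type*} [Field K] [AddCommGroup A] [Module K A]
    (𝒜 : ℤ → Submodule K A) (d : A →ₗ[K] A) (j : ℤ) : Submodule K (Homology d) :=
  ((𝒜 j).submoduleOf (LinearMap.ker d)).map
    ((LinearMap.range d).submoduleOf (LinearMap.ker d)).mkQ

/-- The map `[x] ↦ [f x]` induced in homology by a chain map `f`. -/
def homologyMap {K A B : Type*} [Field K] [AddCommGroup A] [Module K A] [AddCommGroup B]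
    [Module K B] {dA : A →ₗ[K] A} {dB : B →ₗ[K] B} (f : A →ₗ[K] B)
    (hf : f ∘ₗ dA = dB ∘ₗ f) : Homology dA →ₗ[K] Homology dB :=
  Submodule.mapQ _ _
    (f.restrict (p := LinearMap.ker dA) (q := LinearMap.ker dB) (fun x hx => by
      have h := LinearMap.congr_fun hf x
      simp only [LinearMap.comp_apply] at h
      rw [LinearMap.mem_ker] at hx ⊢
      rw [← h, hx, map_zero]))
    (by
      rintro ⟨x, hx⟩ ⟨y, hy⟩
      refine ⟨f y, ?_⟩
      have h := LinearMap.congr_fun hf y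
      simp only [LinearMap.comp_apply] at h
      simp only [Submodule.subtype_apply] at hy
      simp only [Submodule.subtype_apply, LinearMap.coe_restrict_apply]
      rw [← h, hy])

/-- A homotopy retract of the chain complex `(A, dA)` onto the chain complex `(H, dH)`. -/
structure HomotopyRetract {K A H : Type*} [Field K] [AddCommGroup A] [Module K A]
    [AddCommGroup H] [Module K H] (𝒜 : ℤ → Submodule K A) (dA : A →ₗ[K] A)
    (ℋ : ℤ → Submodule K H) (dH : H →ₗ[K] H) where
  p : A →ₗ[K] H
  i : H →ₗ[K] A
  h : A →ₗ[K] A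
  p_degree : HasDegree 𝒜 ℋ p 0
  i_degree : HasDegree ℋ 𝒜 i 0
  h_degree : HasDegree 𝒜 𝒜 h 1
  p_comm : p ∘ₗ dA = dH ∘ₗ p
  i_comm : i ∘ₗ dH = dA ∘ₗ i
  i_quasiIso : Function.Bijective (homologyMap i i_comm)
  homotopy : i ∘ₗ p - LinearMap.id = dA ∘ₗ h + h ∘ₗ dA

/-! ### Multicomplexes -/

/-- A multicomplex structure `(d = Δ 0, Δ 1, Δ 2, …)` on the graded vector space `(A, 𝒜)`. -/
structure Multicomplex {K A : Type*} [Field K] [AddCommGroup A] [Module K A]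
    (𝒜 : ℤ → Submodule K A) where
  Δ : ℕ → (A →ₗ[K] A)
  degree : ∀ n : ℕ, HasDegree 𝒜 𝒜 (Δ n) (2 * n - 1)
  relation : ∀ n : ℕ, ∑ ij ∈ Finset.HasAntidiagonal.antidiagonal n, Δ ij.1 ∘ₗ Δ ij.2 = 0

namespace Multicomplex

/-- The transferred operator
`Δ'_n = ∑_{i₁ + ⋯ + i_k = n} p Δ_{i₁} h Δ_{i₂} h ⋯ h Δ_{i_k} i`,
the sum being over all `k ≥ 1` and all `i₁, …, i_k ≥ 1`, for `n ≥ 1`. -/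
def transferred {K A H : Type*} [Field K] [AddCommGroup A] [Module K A]
    [AddCommGroup H] [Module K H] {𝒜 : ℤ → Submodule K A} (M : Multicomplex 𝒜)
    {ℋ : ℤ → Submodule K H} {dH : H →ₗ[K] H} (R : HomotopyRetract 𝒜 (M.Δ 0) ℋ dH) (n : ℕ) :
    H →ₗ[K] H :=
  ∑ c : Composition n,
    R.p ∘ₗ (((c.blocks.map M.Δ).intersperse R.h : List (Module.End K A)).prod) ∘ₗ R.i

/-- Homotopy retracts of `(A, d)` onto its homology `(H(A, d), 0)`. -/
abbrev HomologyRetract {K A : Type*} [Field K] [AddCommGroup A] [Module K A]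
    {𝒜 : ℤ → Submodule K A} (M : Multicomplex 𝒜) : Type _ :=
  HomotopyRetract 𝒜 (M.Δ 0) (homologyGrading 𝒜 (M.Δ 0)) 0

/-- Hodge-to-de Rham degeneration data. -/
structure DegenerationData {K A : Type*} [Field K] [AddCommGroup A] [Module K A]
    {𝒜 : ℤ → Submodule K A} (M : Multicomplex 𝒜) where
  retract : M.HomologyRetract
  vanishing : ∀ n : ℕ, 1 ≤ n → M.transferred retract n = 0

end Multicomplex

/-! ### The spectral sequence of a filtered complex -/

/-- A chain complex with a decreasing filtration, inside an ambient vector space `M`: `deg n` is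
its degree `n` part, `fil p ⊓ deg n` is the `p`-th step of the filtration in degree `n`, and `d`
is the differential. -/
structure FilteredComplex (K M : Type*) [Field K] [AddCommGroup M] [Module K M] where
  deg : ℤ → Submodule K M
  fil : ℤ → Submodule K M
  d : M →ₗ[K] M
  d_deg : ∀ (n : ℤ) (x : M), x ∈ deg n → d x ∈ deg (n - 1)
  d_fil : ∀ (p : ℤ) (x : M), x ∈ fil p → d x ∈ fil p
  fil_antitone : Antitone fil
  d_d : ∀ x : M, d (d x) = 0

namespace FilteredComplex

variable {K M : Type*} [Field K] [AddCommGroup M] [Module K M] (X : FilteredComplex K M)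

/-- `Z^r_p` in degree `n`: the `x ∈ F_p` with `d x ∈ F_{p+r}`. -/
def cycles (r : ℕ) (p n : ℤ) : Submodule K M :=
  X.deg n ⊓ X.fil p ⊓ (X.fil (p + r)).comap X.d

/-- `Z^{r-1}_{p+1} + d Z^{r-1}_{p-r+1}` in degree `n`. -/
def boundaries (r : ℕ) (p n : ℤ) : Submodule K M :=
  (X.deg n ⊓ X.fil (p + 1) ⊓ (X.fil (p + r)).comap X.d) ⊔
    (X.fil p ⊓ (X.deg (n + 1) ⊓ X.fil (p - r + 1)).map X.d)

theorem boundaries_le_cycles (r : ℕ) (p n : ℤ) : X.boundaries r p n ≤ X.cycles r p n := by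
  refine sup_le ?_ ?_
  · rintro x ⟨⟨h1, h2⟩, h3⟩
    exact ⟨⟨h1, X.fil_antitone (by omega) h2⟩, h3⟩
  · rintro _ ⟨h1, y, ⟨hy, -⟩, rfl⟩
    have h4 := X.d_deg _ _ hy
    rw [add_sub_cancel_right] at h4
    refine ⟨⟨h4, h1⟩, ?_⟩
    simp [X.d_d]

/-- The page `E^r`, at filtration index `p` and total degree `n`. -/
abbrev page (r : ℕ) (p n : ℤ) : Type _ :=
  X.cycles r p n ⧸ (X.boundaries r p n).submoduleOf (X.cycles r p n)

theorem d_cycles (r : ℕ) (p n : ℤ) (x : M) (hx : x ∈ X.cycles r p n) :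
    X.d x ∈ X.cycles r (p + r) (n - 1) := by
  obtain ⟨⟨h1, h2⟩, h3⟩ := hx
  refine ⟨⟨X.d_deg _ _ h1, h3⟩, ?_⟩
  simp [X.d_d]

theorem d_boundaries (r : ℕ) (p n : ℤ) (x : M) (hx : x ∈ X.boundaries r p n) :
    X.d x ∈ X.boundaries r (p + r) (n - 1) := by
  obtain ⟨y, ⟨⟨h1, h2⟩, h3⟩, z, ⟨-, w, -, rfl⟩, rfl⟩ := Submodule.mem_sup.1 hx
  rw [map_add, X.d_d, add_zero]
  refine Submodule.mem_sup_right ⟨h3, y, ⟨?_, ?_⟩, rfl⟩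
  · simpa using h1
  · simpa using h2

/-- The differential `d^r : E^r_p → E^r_{p+r}` of the `r`-th page, induced by `d`. -/
def pageDifferential (r : ℕ) (p n : ℤ) : X.page r p n →ₗ[K] X.page r (p + r) (n - 1) :=
  Submodule.mapQ _ _
    (X.d.restrict (p := X.cycles r p n) (q := X.cycles r (p + r) (n - 1)) (X.d_cycles r p n))
    (fun x hx => X.d_boundaries r p n x.1 hx)

/-- The spectral sequence degenerates at the first page: all `d^r` with `r ≥ 1` vanish. -/
def DegeneratesAtFirstPage : Prop :=
  ∀ r : ℕ, 1 ≤ r → ∀ p n : ℤ, X.pageDifferential r p n = 0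

end FilteredComplex

/-! ### The total complex of a multicomplex, filtered by rows -/

/-- Families `(x_q)_{q ∈ ℤ}` in `A` with `x_q = 0` for `q ≫ 0`. On these the operator
`(∂ x)_q = ∑_{r ≥ 0} Δ_r x_{q+r}` is given by finite sums. -/
def eventuallyZero (K A : Type*) [Field K] [AddCommGroup A] [Module K A] :
    Submodule K (ℤ → A) where
  carrier := {x | ∃ N : ℤ, ∀ q, N < q → x q = 0}
  zero_mem' := ⟨0, fun _ _ => rfl⟩
  add_mem' := by
    rintro x y ⟨N, hN⟩ ⟨N', hN'⟩
    refine ⟨max N N', fun q hq => ?_⟩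
    simp [hN q (lt_of_le_of_lt (le_max_left _ _) hq),
      hN' q (lt_of_le_of_lt (le_max_right _ _) hq)]
  smul_mem' := by
    rintro c x ⟨N, hN⟩
    exact ⟨N, fun q hq => by simp [hN q hq]⟩

namespace Multicomplex

variable {K A : Type*} [Field K] [AddCommGroup A] [Module K A] {𝒜 : ℤ → Submodule K A}
  (M : Multicomplex 𝒜)

theorem finite_support (x : eventuallyZero K A) (q : ℤ) :
    (Function.support fun r : ℕ => M.Δ r (x.1 (q + r))).Finite := by
  obtain ⟨x, N, hN⟩ := x
  refine (Set.finite_Iic (N - q).toNat).subset fun r hr => ?_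
  by_contra hlt
  refine hr ?_
  simp only [Set.mem_Iic, not_le] at hlt
  simp [hN (q + r) (by omega)]

/-- The total differential `∂ = ∑_{r ≥ 0} ∂_r`, where `∂_r = Δ_r : C_{p,q} → C_{p-1+r,q-r}`;
that is, the component of `∂ x` in row `q` is the finite sum `∑_{r ≥ 0} Δ_r x_{q+r}`. -/
noncomputable def totalDifferential : eventuallyZero K A →ₗ[K] eventuallyZero K A where
  toFun x := ⟨fun q => ∑ᶠ r : ℕ, M.Δ r (x.1 (q + r)), by
    obtain ⟨x, N, hN⟩ := x
    refine ⟨N, fun q hq => ?_⟩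
    have h : ∀ r : ℕ, M.Δ r (x (q + r)) = 0 := fun r => by rw [hN _ (by omega), map_zero]
    simp [h]⟩
  map_add' x y := by
    ext q
    simp only [Submodule.coe_add, Pi.add_apply, map_add]
    exact finsum_add_distrib (M.finite_support x q) (M.finite_support y q)
  map_smul' c x := by
    ext q
    simp only [Submodule.coe_smul, Pi.smul_apply, map_smul, RingHom.id_apply]
    exact (smul_finsum' c (M.finite_support x q)).symm

theorem totalDifferential_apply (x : eventuallyZero K A) (q : ℤ) :
    (M.totalDifferential x).1 q = ∑ᶠ r : ℕ, M.Δ r (x.1 (q + r)) := rfl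

theorem totalDifferential_apply_eq_sum (x : eventuallyZero K A) (N : ℤ)
    (hN : ∀ q, N < q → x.1 q = 0) (q : ℤ) (m : ℕ) (hm : N < q + m) :
    (M.totalDifferential x).1 q = ∑ r ∈ Finset.range m, M.Δ r (x.1 (q + r)) := by
  rw [totalDifferential_apply]
  refine finsum_eq_sum_of_support_subset _ fun r hr => ?_
  by_contra hlt
  refine hr ?_
  simp only [Finset.coe_range, Set.mem_Iio, not_lt] at hlt
  simp [hN (q + r) (by omega)]

theorem totalDifferential_sq (x : eventuallyZero K A) :
    M.totalDifferential (M.totalDifferential x) = 0 := by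
  obtain ⟨N, hN⟩ := x.2
  have hN' : ∀ q, N < q → (M.totalDifferential x).1 q = 0 := fun q hq => by
    rw [M.totalDifferential_apply_eq_sum x N hN q 0 (by simpa using hq)]
    simp
  ext q
  obtain ⟨m, hm⟩ : ∃ m : ℕ, N < q + m := ⟨(N - q + 1).toNat, by omega⟩
  rw [M.totalDifferential_apply_eq_sum _ N hN' q m hm]
  have h1 : ∀ r ∈ Finset.range m, M.Δ r ((M.totalDifferential x).1 (q + r)) =
      ∑ s ∈ Finset.range (m - r), M.Δ r (M.Δ s (x.1 (q + r + s))) := fun r hr => by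
    rw [Finset.mem_range] at hr
    rw [M.totalDifferential_apply_eq_sum x N hN (q + r) (m - r) (by omega), map_sum]
  rw [Finset.sum_congr rfl h1,
    ← Finset.sum_range_diag_flip m fun r s => M.Δ r (M.Δ s (x.1 (q + r + s)))]
  refine Finset.sum_eq_zero fun n _ => ?_
  have h2 := LinearMap.congr_fun (M.relation n) (x.1 (q + n))
  rw [Finset.Nat.sum_antidiagonal_eq_sum_range_succ_mk, LinearMap.sum_apply] at h2
  refine Eq.trans (Finset.sum_congr rfl fun k hk => ?_) h2
  rw [Finset.mem_range] at hk
  have h3 : q + (k : ℤ) + ((n - k : ℕ) : ℤ) = q + n := by omega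
  rw [h3]
  rfl

end Multicomplex

/-- `C_{p,q} = A_{p-q}`. -/
def bigraded {K A : Type*} [Field K] [AddCommGroup A] [Module K A] (𝒜 : ℤ → Submodule K A)
    (p q : ℤ) : Submodule K A :=
  𝒜 (p - q)

/-- The degree `n` part of the total complex: the families
`(x_q)_q ∈ ∏_{p+q=n} C_{p,q} = ∏_q C_{n-q,q}` with `x_q = 0` for `q ≫ 0`. -/
def totalDegree {K A : Type*} [Field K] [AddCommGroup A] [Module K A] (𝒜 : ℤ → Submodule K A)
    (n : ℤ) : Submodule K (eventuallyZero K A) :=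
  (Submodule.pi Set.univ fun q => bigraded 𝒜 (n - q) q).comap (eventuallyZero K A).subtype

/-- The row filtration: `F_s` consists of the families supported in the rows `q ≤ -s`. -/
def rowFiltration (K A : Type*) [Field K] [AddCommGroup A] [Module K A] (s : ℤ) :
    Submodule K (eventuallyZero K A) where
  carrier := {x | ∀ q, -s < q → x.1 q = 0}
  zero_mem' := fun _ _ => rfl
  add_mem' := by
    intro x y hx hy q hq
    simp [hx q hq, hy q hq]
  smul_mem' := by
    intro c x hx q hq
    simp [hx q hq]

/-- If `A` is bounded below, the condition `x_q = 0` for `q ≫ 0` is automatic, so that the total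
complex is the full product. -/
theorem mem_eventuallyZero_of_bddBelow {K A : Type*} [Field K] [AddCommGroup A] [Module K A]
    (𝒜 : ℤ → Submodule K A) (b : ℤ) (hb : ∀ j, j < b → 𝒜 j = ⊥) (n : ℤ) (x : ℤ → A)
    (hx : ∀ q, x q ∈ bigraded 𝒜 (n - q) q) : x ∈ eventuallyZero K A := by
  refine ⟨max (n - b) 0, fun q hq => ?_⟩
  have h := hx q
  rw [bigraded, hb _ (by omega)] at h
  simpa using h

/-- In general the steps of the filtration are the full products over the rows `q ≤ -s`. -/
theorem mem_eventuallyZero_of_rows {K A : Type*} [Field K] [AddCommGroup A] [Module K A]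
    (s : ℤ) (x : ℤ → A) (hx : ∀ q, -s < q → x q = 0) : x ∈ eventuallyZero K A :=
  ⟨-s, hx⟩

namespace Multicomplex

/-- The total complex of a multicomplex, filtered by rows. -/
noncomputable def totalComplex {K A : Type*} [Field K] [AddCommGroup A] [Module K A]
    {𝒜 : ℤ → Submodule K A} (M : Multicomplex 𝒜) : FilteredComplex K (eventuallyZero K A) where
  deg := totalDegree 𝒜
  fil := rowFiltration K A
  d := M.totalDifferential
  d_deg n x hx := by
    intro q _
    obtain ⟨N, hN⟩ := x.2
    obtain ⟨m, hm⟩ : ∃ m : ℕ, N < q + m := ⟨(N - q + 1).toNat, by omega⟩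
    change (M.totalDifferential x).1 q ∈ _
    rw [M.totalDifferential_apply_eq_sum x N hN q m hm]
    refine Submodule.sum_mem _ fun r _ => ?_
    have h1 := M.degree r _ _ (hx (q + r) (Set.mem_univ _))
    have h2 : n - (q + (r : ℤ)) - (q + r) + (2 * r - 1) = n - 1 - q - q := by ring
    rw [h2] at h1
    exact h1
  d_fil s x hx := by
    intro q hq
    rw [M.totalDifferential_apply_eq_sum x (-s) hx q 0 (by simpa using hq)]
    simp
  fil_antitone := fun s t hst x hx q hq => hx q (by omega)
  d_d := M.totalDifferential_sq

end Multicomplex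

/-! ### The perturbation lemma in a ring -/

section Perturbation

variable {R : Type*} [Ring R] {d δ h a : R}

/-! Write the multicomplex as a power series d + δ over `Module.End K A`, with d = Δ_0 and δ of
positive order. Series act on families, the r-th coefficient moving entries r rows down
(`rowOperator`), and ∂ is the action of d + δ. For a retract put e = ip = 1 + dh + hd and a = δ +
δhδ + ⋯ (`transferSeries`). Since de = ed = 0, the perturbation lemma gives (d + δ)(1 + ha)e = (1 +
ha)eae and e(1 + ah)(d + δ) = eae(1 + ah) (`mk_mul_inclusion`, `projection_mul_mk`). As pi = 1, the
series eae = iΔ'p vanishes exactly when all Δ'_n do.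

If eae = 0, then (1 + ha)e turns any single entry into a ∂-cycle. Subtracting such a cycle, up to a
boundary, removes the leading entry of any x in Z^r_p, r ≥ 1, without changing ∂x, so d^r = 0.
Conversely, if eae has order n, then d^n sees its n-th coefficient, and applying e(1 + ah) shows
that no element of the denominator of E^n can absorb it; degeneration forces that coefficient to
vanish.

The equivalence with degeneration data then only needs one retract, which is built from a
generalized inverse of d. -/

theorem perturbation_identity
    (hl : ∀ f : R, f = δ * h * f → f = 0) (hr : ∀ f : R, f = f * (h * δ) → f = 0)
    (hd : d * d = 0) (hD : (d + δ) * (d + δ) = 0)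
    (ha : a = δ + δ * h * a) (ha' : a = δ + a * h * δ) :
    a * (1 + d * h + h * d) * a + a * d + d * a = 0 := by
  have hD' : δ * d + d * δ + δ * δ = 0 := by
    have h1 : (d + δ) * (d + δ) = d * d + (δ * d + d * δ + δ * δ) := by noncomm_ring
    rwa [hD, hd, zero_add, eq_comm] at h1
  -- This expression is (1 - δh) times the left side of the goal. Multiplied by 1 - hδ on the right
  -- it collapses to δd + dδ + δδ = 0, so cancelling on either side finishes the proof.
  have hW : δ * d * (1 + h * a) + d * a + δ * a = 0 := by
    refine hr _ (sub_eq_zero.1 ?_)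
    calc δ * d * (1 + h * a) + d * a + δ * a -
          (δ * d * (1 + h * a) + d * a + δ * a) * (h * δ)
        = δ * d * (1 + h * (a - (δ + a * h * δ))) + d * (a - a * h * δ)
            + δ * (a - a * h * δ) := by noncomm_ring
      _ = 0 := by
        rw [← ha', sub_self, mul_zero, add_zero, mul_one, show a - a * h * δ = δ from sub_eq_of_eq_add ha', ← hD',
          add_assoc]
  refine hl _ (sub_eq_zero.1 ?_)
  calc a * (1 + d * h + h * d) * a + a * d + d * a -
        δ * h * (a * (1 + d * h + h * d) * a + a * d + d * a)
      = (a - δ * h * a) * (1 + d * h + h * d) * a + (a - δ * h * a) * d + d * a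
          - δ * h * d * a := by noncomm_ring
    _ = δ * d * (1 + h * a) + d * a + δ * a := by
      rw [show a - δ * h * a = δ from sub_eq_of_eq_add ha]
      noncomm_ring
    _ = 0 := hW

theorem perturbation_inclusion (ha : a = δ + δ * h * a)
    (hT : a * (1 + d * h + h * d) * a + a * d + d * a = 0) :
    (d + δ) * (1 + h * a) = (1 + h * a) * (d + (1 + d * h + h * d) * a) := by
  rw [← sub_eq_zero]
  calc (d + δ) * (1 + h * a) - (1 + h * a) * (d + (1 + d * h + h * d) * a)
      = (δ + δ * h * a - a) - h * (a * (1 + d * h + h * d) * a + a * d + d * a) := by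
        noncomm_ring
    _ = 0 := by rw [hT, ← ha, sub_self, mul_zero, sub_zero]

theorem perturbation_projection (ha : a = δ + a * h * δ)
    (hT : a * (1 + d * h + h * d) * a + a * d + d * a = 0) :
    (1 + a * h) * (d + δ) = (d + a * (1 + d * h + h * d)) * (1 + a * h) := by
  rw [← sub_eq_zero]
  calc (1 + a * h) * (d + δ) - (d + a * (1 + d * h + h * d)) * (1 + a * h)
      = (δ + a * h * δ - a) - (a * (1 + d * h + h * d) * a + a * d + d * a) * h := by
        noncomm_ring
    _ = 0 := by rw [hT, ← ha, sub_self, zero_mul, sub_zero]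

end Perturbation

/-! ### Cancellation of `1 - g` for power series `g` without constant term -/

namespace PowerSeries

variable {R : Type*} [Ring R]

/-- As `g` has no constant term, each coefficient of `g * f` involves only strictly lower
coefficients of `f`. This replaces inverting `1 - g`. -/
theorem eq_zero_of_eq_mul_left {f g : R⟦X⟧} (hg : coeff 0 g = 0) (h : f = g * f) : f = 0 := by
  ext n
  induction n using Nat.strong_induction_on with
  | _ n ih =>
    rw [h, coeff_mul, map_zero]
    refine Finset.sum_eq_zero fun ⟨k, m⟩ hkm => ?_
    rw [Finset.HasAntidiagonal.mem_antidiagonal] at hkm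
    rcases Nat.eq_zero_or_pos k with rfl | hk
    · simp only [hg, zero_mul]
    · simp only at hkm ⊢
      rw [ih m (by omega), map_zero, mul_zero]

theorem eq_zero_of_eq_mul_right {f g : R⟦X⟧} (hg : coeff 0 g = 0) (h : f = f * g) : f = 0 := by
  ext n
  induction n using Nat.strong_induction_on with
  | _ n ih =>
    rw [h, coeff_mul, map_zero]
    refine Finset.sum_eq_zero fun ⟨k, m⟩ hkm => ?_
    rw [Finset.HasAntidiagonal.mem_antidiagonal] at hkm
    rcases Nat.eq_zero_or_pos m with rfl | hk
    · simp only [hg, mul_zero]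
    · simp only at hkm ⊢
      rw [ih k (by omega), map_zero, zero_mul]

end PowerSeries

/-! ### Sums over compositions -/

/-- Decomposing a sum over compositions according to the first block. -/
theorem Composition.sum_eq_sum_antidiagonal_cons {R : Type*} [AddCommMonoid R] (F : List ℕ → R)
    {n : ℕ} (hn : 1 ≤ n) :
    ∑ c : Composition n, F c.blocks =
      ∑ km ∈ (Finset.HasAntidiagonal.antidiagonal n).filter (fun km => 1 ≤ km.1),
        ∑ c : Composition km.2, F (km.1 :: c.blocks) := by
  rw [Finset.sum_sigma']
  symm
  refine Finset.sum_bij (fun x hx => ⟨x.1.1 :: x.2.blocks, ?_, ?_⟩) ?_ ?_ ?_ ?_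
  · intro i hi
    simp only [Finset.mem_sigma, Finset.mem_filter] at hx
    rcases List.mem_cons.1 hi with rfl | hi
    · exact hx.1.2
    · exact x.2.blocks_pos hi
  · simp only [Finset.mem_sigma, Finset.mem_filter, Finset.HasAntidiagonal.mem_antidiagonal] at hx
    rw [List.sum_cons, x.2.blocks_sum, hx.1.1]
  · intros; exact Finset.mem_univ _
  · rintro ⟨⟨k, m⟩, c⟩ hc ⟨⟨k', m'⟩, c'⟩ hc' h
    simp only [Composition.mk.injEq, List.cons.injEq] at h
    obtain ⟨rfl, h⟩ := h
    have hm : m = m' := by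
      have h1 : c.blocks.sum = m := c.blocks_sum
      have h2 : c'.blocks.sum = m' := c'.blocks_sum
      rw [← h1, ← h2, h]
    subst hm
    obtain rfl : c = c' := Composition.ext h
    rfl
  · rintro ⟨l, hl, hs⟩ -
    cases l with
    | nil => simp at hs; omega
    | cons k l =>
      refine ⟨⟨(k, l.sum), ⟨l, fun hi => hl (List.mem_cons_of_mem _ hi), rfl⟩⟩, ?_, rfl⟩
      simp only [Finset.mem_sigma, Finset.mem_filter, Finset.HasAntidiagonal.mem_antidiagonal, Finset.mem_univ,
        and_true]
      exact ⟨by simpa using hs, hl List.mem_cons_self⟩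
  · intros; rfl

/-- The power series with coefficients
`∑ D i₁ * h * D i₂ * h * ⋯ * h * D i_k` over the compositions `(i₁, …, i_k)` of `n ≥ 1`. -/
noncomputable def transferSeries {R : Type*} [Ring R] (D : ℕ → R) (h : R) : PowerSeries R :=
  PowerSeries.mk fun n => if n = 0 then 0 else
    ∑ c : Composition n, ((c.blocks.map D).intersperse h).prod

/-- The part of positive order of the power series with coefficients `D n`. -/
noncomputable def perturbationSeries {R : Type*} [Ring R] (D : ℕ → R) : PowerSeries R :=
  PowerSeries.mk fun n => if n = 0 then 0 else D n

/-! ### Recursions and perturbation identities for the transfer series -/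

section TransferSeries

open PowerSeries

variable {R : Type*} [Ring R] (D : ℕ → R) (h : R)

theorem coeff_zero_transferSeries : coeff 0 (transferSeries D h) = 0 := by
  rw [transferSeries, coeff_mk, if_pos rfl]

theorem coeff_zero_perturbationSeries : coeff 0 (perturbationSeries D) = 0 := by
  rw [perturbationSeries, coeff_mk, if_pos rfl]

theorem coeff_transferSeries {n : ℕ} (hn : 1 ≤ n) :
    coeff n (transferSeries D h) =
      ∑ c : Composition n, ((c.blocks.map D).intersperse h).prod := by
  rw [transferSeries, coeff_mk, if_neg (by omega)]

theorem coeff_perturbationSeries {n : ℕ} (hn : 1 ≤ n) :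
    coeff n (perturbationSeries D) = D n := by
  rw [perturbationSeries, coeff_mk, if_neg (by omega)]

theorem C_add_perturbationSeries : C (D 0) + perturbationSeries D = mk D := by
  ext n
  rcases Nat.eq_zero_or_pos n with rfl | hn
  · rw [map_add, coeff_zero_perturbationSeries, coeff_zero_C, coeff_mk, add_zero]
  · rw [map_add, coeff_perturbationSeries D hn, coeff_C_of_ne_zero (by omega), coeff_mk, zero_add]

theorem transferSeries_eq :
    transferSeries D h =
      perturbationSeries D + perturbationSeries D * C h * transferSeries D h := by
  ext n
  rcases Nat.eq_zero_or_pos n with rfl | hn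
  · rw [map_add, coeff_zero_transferSeries, coeff_zero_perturbationSeries, coeff_mul,
      Finset.Nat.antidiagonal_zero, Finset.sum_singleton, coeff_zero_transferSeries, mul_zero,
      add_zero]
  -- The one-block composition is the case `km.2 = 0`. It needs its own summand because the constant
  -- term of the transfer series is set to 0, although there is one composition of 0.
  have key : ∀ km ∈ (Finset.HasAntidiagonal.antidiagonal n).filter (fun km => 1 ≤ km.1),
      ∑ c : Composition km.2, (((km.1 :: c.blocks).map D).intersperse h).prod =
        (if km.2 = 0 then D n else 0) +
          coeff km.1 (perturbationSeries D * C h) * coeff km.2 (transferSeries D h) := by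
    rintro ⟨k, m⟩ hkm
    rw [Finset.mem_filter, Finset.HasAntidiagonal.mem_antidiagonal] at hkm
    obtain ⟨hkm, hk⟩ := hkm
    simp only at hkm hk ⊢
    rcases Nat.eq_zero_or_pos m with rfl | hm
    · obtain rfl : k = n := by omega
      have hnil : ∀ c : Composition 0, c.blocks = [] := fun c => by
        rw [← List.length_eq_zero_iff]
        have := c.length_le
        exact Nat.le_zero.1 this
      have : ∀ c : Composition 0, (((k :: c.blocks).map D).intersperse h).prod = D k :=
        fun c => by simp [hnil c]
      simp only [this, coeff_zero_transferSeries]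
      simp [composition_card]
    · rw [if_neg (by omega), zero_add, coeff_mul_C, coeff_perturbationSeries D hk,
        coeff_transferSeries D h hm, Finset.mul_sum]
      refine Finset.sum_congr rfl fun c _ => ?_
      cases hc : c.blocks with
      | nil =>
        have := c.blocks_sum
        rw [hc, List.sum_nil] at this
        omega
      | cons b l => simp [mul_assoc]
  rw [coeff_transferSeries D h hn,
    Composition.sum_eq_sum_antidiagonal_cons (fun l => ((l.map D).intersperse h).prod) hn,
    Finset.sum_congr rfl key, Finset.sum_add_distrib, map_add, coeff_perturbationSeries D hn]
  congr 1
  · rw [Finset.sum_eq_single (n, 0)]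
    · simp
    · rintro ⟨k, m⟩ hkm hne
      rw [Finset.mem_filter, Finset.HasAntidiagonal.mem_antidiagonal] at hkm
      refine if_neg fun hm => hne ?_
      simp only at hm hkm
      subst hm
      simpa using hkm.1
    · intro hmem
      exact absurd (by simpa using Nat.one_le_of_lt hn) hmem
  · rw [coeff_mul (n := n), Finset.sum_filter]
    refine Finset.sum_congr rfl fun km _ => ?_
    split_ifs with hk
    · rfl
    · rw [show km.1 = 0 by omega, coeff_mul_C, coeff_zero_perturbationSeries, zero_mul, zero_mul]

/-- Peels off the last block instead of the first. No second count of compositions is needed: by the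
first recursion, 1 - δh annihilates the difference of the two sides from the left. -/
theorem transferSeries_eq' :
    transferSeries D h =
      perturbationSeries D + transferSeries D h * C h * perturbationSeries D := by
  have hl := transferSeries_eq D h
  set a := transferSeries D h
  set δ := perturbationSeries D with hδ
  rw [← sub_eq_zero]
  refine eq_zero_of_eq_mul_left (g := δ * C h) ?_ (sub_eq_zero.1 ?_)
  · rw [coeff_mul_C, hδ, coeff_zero_perturbationSeries, zero_mul]
  · calc a - (δ + a * C h * δ) - δ * C h * (a - (δ + a * C h * δ))
        = (a - δ * C h * a - δ) - (a - δ * C h * a - δ) * C h * δ := by noncomm_ring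
      _ = 0 := by
        rw [show a - δ * C h * a = δ from sub_eq_of_eq_add hl, sub_self, zero_mul, zero_mul,
          sub_zero]

variable {D}

theorem transferSeries_identity (hD : mk D * mk D = 0) :
    transferSeries D h * (1 + C (D 0) * C h + C h * C (D 0)) * transferSeries D h +
      transferSeries D h * C (D 0) + C (D 0) * transferSeries D h = 0 := by
  refine perturbation_identity (δ := perturbationSeries D) (fun f => eq_zero_of_eq_mul_left ?_)
    (fun f => eq_zero_of_eq_mul_right ?_) ?_ ?_ (transferSeries_eq D h) (transferSeries_eq' D h)
  · rw [coeff_mul_C, coeff_zero_perturbationSeries, zero_mul]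
  · rw [coeff_C_mul, coeff_zero_perturbationSeries, mul_zero]
  · have h0 := congrArg (coeff 0) hD
    rw [coeff_mul, Finset.Nat.antidiagonal_zero, Finset.sum_singleton, coeff_mk, map_zero] at h0
    rw [← map_mul, h0, map_zero]
  · rw [C_add_perturbationSeries, hD]

theorem mk_mul_one_add_transferSeries (hD : mk D * mk D = 0) :
    mk D * (1 + C h * transferSeries D h) = (1 + C h * transferSeries D h) *
      (C (D 0) + (1 + C (D 0) * C h + C h * C (D 0)) * transferSeries D h) := by
  rw [← C_add_perturbationSeries]
  exact perturbation_inclusion (transferSeries_eq D h) (transferSeries_identity h hD)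

theorem one_add_transferSeries_mul_mk (hD : mk D * mk D = 0) :
    (1 + transferSeries D h * C h) * mk D =
      (C (D 0) + transferSeries D h * (1 + C (D 0) * C h + C h * C (D 0))) *
        (1 + transferSeries D h * C h) := by
  rw [← C_add_perturbationSeries]
  exact perturbation_projection (transferSeries_eq' D h) (transferSeries_identity h hD)

end TransferSeries

/-! ### Power series of operators acting on families -/

section RowOperator

open PowerSeries

variable {K A : Type*} [Field K] [AddCommGroup A] [Module K A]

theorem finite_support_coeff_apply (f : (Module.End K A)⟦X⟧) (x : eventuallyZero K A) (q : ℤ) :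
    (Function.support fun r : ℕ => coeff r f (x.1 (q + r))).Finite := by
  obtain ⟨x, N, hN⟩ := x
  refine (Set.finite_Iic (N - q).toNat).subset fun r hr => ?_
  by_contra hlt
  refine hr ?_
  simp only [Set.mem_Iic, not_le] at hlt
  simp [hN (q + r) (by omega)]

/-- The operator `(f x)_q = ∑_{r ≥ 0} f_r x_{q+r}` on families `x` attached to a power series `f`
of operators. -/
noncomputable def rowOperator (f : (Module.End K A)⟦X⟧) :
    eventuallyZero K A →ₗ[K] eventuallyZero K A where
  toFun x := ⟨fun q => ∑ᶠ r : ℕ, coeff r f (x.1 (q + r)), by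
    obtain ⟨x, N, hN⟩ := x
    refine ⟨N, fun q hq => ?_⟩
    have h : ∀ r : ℕ, coeff r f (x (q + r)) = 0 := fun r => by rw [hN _ (by omega), map_zero]
    simp [h]⟩
  map_add' x y := by
    ext q
    simp only [Submodule.coe_add, Pi.add_apply, map_add]
    exact finsum_add_distrib (finite_support_coeff_apply f x q) (finite_support_coeff_apply f y q)
  map_smul' c x := by
    ext q
    simp only [Submodule.coe_smul, Pi.smul_apply, map_smul, RingHom.id_apply]
    exact (smul_finsum' c (finite_support_coeff_apply f x q)).symm

theorem rowOperator_apply (f : (Module.End K A)⟦X⟧) (x : eventuallyZero K A) (q : ℤ) :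
    (rowOperator f x).1 q = ∑ᶠ r : ℕ, coeff r f (x.1 (q + r)) := rfl

theorem rowOperator_apply_eq_sum (f : (Module.End K A)⟦X⟧) (x : eventuallyZero K A) (N : ℤ)
    (hN : ∀ q, N < q → x.1 q = 0) (q : ℤ) (m : ℕ) (hm : N < q + m) :
    (rowOperator f x).1 q = ∑ r ∈ Finset.range m, coeff r f (x.1 (q + r)) := by
  rw [rowOperator_apply]
  refine finsum_eq_sum_of_support_subset _ fun r hr => ?_
  by_contra hlt
  refine hr ?_
  simp only [Finset.coe_range, Set.mem_Iio, not_lt] at hlt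
  simp [hN (q + r) (by omega)]

theorem rowOperator_zero : rowOperator (0 : (Module.End K A)⟦X⟧) = 0 := by
  ext x q
  simp [rowOperator_apply]

theorem rowOperator_mem_rowFiltration {f : (Module.End K A)⟦X⟧} {n : ℕ}
    (hf : ∀ k < n, coeff k f = 0) {s : ℤ} {x : eventuallyZero K A}
    (hx : x ∈ rowFiltration K A s) : rowOperator f x ∈ rowFiltration K A (s + n) := by
  intro q hq
  rw [rowOperator_apply, ← finsum_zero (α := ℕ) (M := A)]
  refine finsum_congr fun r => ?_
  by_cases hr : r < n
  · rw [hf r hr, LinearMap.zero_apply]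
  · rw [hx _ (by omega), map_zero]

theorem rowOperator_mem_rowFiltration_self (f : (Module.End K A)⟦X⟧) {s : ℤ}
    {x : eventuallyZero K A} (hx : x ∈ rowFiltration K A s) :
    rowOperator f x ∈ rowFiltration K A s := by
  simpa using rowOperator_mem_rowFiltration (n := 0) (f := f) (by simp) hx

/-- The leading term of `f x` is the leading coefficient of `f` applied to that of `x`. -/
theorem rowOperator_apply_leading {f : (Module.End K A)⟦X⟧} {n : ℕ}
    (hf : ∀ k < n, coeff k f = 0) {s : ℤ} {x : eventuallyZero K A}
    (hx : x ∈ rowFiltration K A s) (q : ℤ) (hq : q = -(s + n)) :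
    (rowOperator f x).1 q = coeff n f (x.1 (-s)) := by
  rw [rowOperator_apply, finsum_eq_single _ n, hq, neg_add, neg_add_cancel_right]
  intro r hr
  rcases lt_or_gt_of_ne hr with hr | hr
  · rw [hf r hr, LinearMap.zero_apply]
  · rw [hx _ (by omega), map_zero]

theorem rowOperator_apply_leading_self (f : (Module.End K A)⟦X⟧) {s : ℤ} {x : eventuallyZero K A}
    (hx : x ∈ rowFiltration K A s) :
    (rowOperator f x).1 (-s) = coeff 0 f (x.1 (-s)) :=
  rowOperator_apply_leading (n := 0) (by simp) hx _ (by simp)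

/-- Makes families a module over the power series ring, so that the perturbation identities can be
applied to ∂. Only finitely many rows contribute to an entry, hence the double sum can be regrouped
along diagonals. -/
theorem rowOperator_mul_apply (f g : (Module.End K A)⟦X⟧) (x : eventuallyZero K A) :
    rowOperator (f * g) x = rowOperator f (rowOperator g x) := by
  obtain ⟨N, hN⟩ := x.2
  have hx : x ∈ rowFiltration K A (-N) := fun q hq => hN q (by omega)
  have hN' : ∀ q, N < q → (rowOperator g x).1 q = 0 := fun q hq =>
    rowOperator_mem_rowFiltration_self g hx q (by omega)
  ext q
  obtain ⟨m, hm⟩ : ∃ m : ℕ, N < q + m := ⟨(N - q + 1).toNat, by omega⟩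
  rw [rowOperator_apply_eq_sum _ x N hN q m hm, rowOperator_apply_eq_sum _ _ N hN' q m hm]
  have h1 : ∀ r ∈ Finset.range m, coeff r f ((rowOperator g x).1 (q + r)) =
      ∑ s ∈ Finset.range (m - r), coeff r f (coeff s g (x.1 (q + r + s))) := fun r hr => by
    rw [Finset.mem_range] at hr
    rw [rowOperator_apply_eq_sum g x N hN (q + r) (m - r) (by omega), map_sum]
  rw [Finset.sum_congr rfl h1,
    ← Finset.sum_range_diag_flip m fun r s => coeff r f (coeff s g (x.1 (q + r + s)))]
  refine Finset.sum_congr rfl fun n _ => ?_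
  rw [coeff_mul, Finset.Nat.sum_antidiagonal_eq_sum_range_succ_mk, LinearMap.sum_apply]
  refine Finset.sum_congr rfl fun k hk => ?_
  rw [Finset.mem_range] at hk
  rw [show q + (k : ℤ) + ((n - k : ℕ) : ℤ) = q + n by omega]
  rfl

theorem rowOperator_mem_totalDegree {𝒜 : ℤ → Submodule K A} {f : (Module.End K A)⟦X⟧} {k : ℤ}
    (hf : ∀ r : ℕ, HasDegree 𝒜 𝒜 (coeff r f) (2 * r + k)) {n : ℤ} {x : eventuallyZero K A}
    (hx : x ∈ totalDegree 𝒜 n) : rowOperator f x ∈ totalDegree 𝒜 (n + k) := by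
  intro q _
  obtain ⟨N, hN⟩ := x.2
  obtain ⟨m, hm⟩ : ∃ m : ℕ, N < q + m := ⟨(N - q + 1).toNat, by omega⟩
  change (rowOperator f x).1 q ∈ _
  rw [rowOperator_apply_eq_sum f x N hN q m hm]
  refine Submodule.sum_mem _ fun r _ => ?_
  have h1 := hf r _ _ (hx (q + r) (Set.mem_univ _))
  rwa [show n - (q + (r : ℤ)) - (q + r) + (2 * r + k) = n + k - q - q by ring] at h1

/-- The family with the single entry `a`, in row `q`. -/
noncomputable def rowSingle (K : Type*) {A : Type*} [Field K] [AddCommGroup A] [Module K A]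
    (q : ℤ) (a : A) : eventuallyZero K A :=
  ⟨Pi.single q a, q, fun _ h => Pi.single_eq_of_ne (M := fun _ => A) h.ne' a⟩

theorem rowSingle_apply_self (q : ℤ) (a : A) : (rowSingle K q a).1 q = a :=
  Pi.single_eq_same (M := fun _ => A) q a

theorem rowSingle_mem_rowFiltration (s : ℤ) (a : A) :
    rowSingle K (-s) a ∈ rowFiltration K A s :=
  fun _ h => Pi.single_eq_of_ne (M := fun _ => A) h.ne' a

theorem rowSingle_mem_totalDegree {𝒜 : ℤ → Submodule K A} {n q : ℤ} {a : A}
    (ha : a ∈ 𝒜 (n - q - q)) : rowSingle K q a ∈ totalDegree 𝒜 n := by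
  intro q' _
  change (Pi.single q a : ℤ → A) q' ∈ 𝒜 (n - q' - q')
  by_cases h : q' = q
  · subst h
    rwa [Pi.single_eq_same]
  · rw [Pi.single_eq_of_ne h]
    exact zero_mem _

theorem Multicomplex.totalDifferential_eq_rowOperator {𝒜 : ℤ → Submodule K A}
    (M : Multicomplex 𝒜) : M.totalDifferential = rowOperator (PowerSeries.mk M.Δ) := by
  ext x q
  rw [rowOperator_apply, M.totalDifferential_apply]
  simp only [coeff_mk]

theorem Multicomplex.mk_mul_mk {𝒜 : ℤ → Submodule K A}
    (M : Multicomplex 𝒜) : PowerSeries.mk M.Δ * PowerSeries.mk M.Δ = 0 := by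
  ext1 n
  rw [coeff_mul, map_zero, ← M.relation n]
  simp only [coeff_mk]
  rfl

end RowOperator

/-! ### Degrees of operators and of the coefficients of the series -/

namespace HasDegree

variable {K A B C : Type*} [Field K] [AddCommGroup A] [Module K A] [AddCommGroup B] [Module K B]
  [AddCommGroup C] [Module K C] {𝒜 : ℤ → Submodule K A} {ℬ : ℤ → Submodule K B}
  {𝒞 : ℤ → Submodule K C}

theorem zero (k : ℤ) : HasDegree 𝒜 ℬ (0 : A →ₗ[K] B) k := fun _ _ _ => zero_mem _

theorem one : HasDegree 𝒜 𝒜 (1 : Module.End K A) 0 := fun j x hx => by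
  rwa [add_zero]

theorem add {f g : A →ₗ[K] B} {k : ℤ} (hf : HasDegree 𝒜 ℬ f k) (hg : HasDegree 𝒜 ℬ g k) :
    HasDegree 𝒜 ℬ (f + g) k := fun j x hx => add_mem (hf j x hx) (hg j x hx)

theorem sum {ι : Type*} {s : Finset ι} {f : ι → A →ₗ[K] B} {k : ℤ}
    (hf : ∀ i ∈ s, HasDegree 𝒜 ℬ (f i) k) : HasDegree 𝒜 ℬ (∑ i ∈ s, f i) k := fun j x hx => by
  rw [LinearMap.sum_apply]
  exact sum_mem fun i hi => hf i hi j x hx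

theorem comp {f : B →ₗ[K] C} {g : A →ₗ[K] B} {k l m : ℤ} (hf : HasDegree ℬ 𝒞 f k)
    (hg : HasDegree 𝒜 ℬ g l) (hm : m = l + k) : HasDegree 𝒜 𝒞 (f ∘ₗ g) m := fun j x hx => by
  rw [hm, ← add_assoc]
  exact hf _ _ (hg j x hx)

theorem mul {f g : Module.End K A} {k l m : ℤ} (hf : HasDegree 𝒜 𝒜 f k)
    (hg : HasDegree 𝒜 𝒜 g l) (hm : m = l + k) : HasDegree 𝒜 𝒜 (f * g) m :=
  hf.comp hg hm

end HasDegree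

section Degree

open PowerSeries

variable {K A : Type*} [Field K] [AddCommGroup A] [Module K A] {𝒜 : ℤ → Submodule K A}

/-- A prefix `D k * h` has degree 2k and a tail of weight m has degree 2m - 1, so the recursion
gives the degree by induction, without expanding over compositions. -/
theorem hasDegree_coeff_transferSeries {D : ℕ → Module.End K A} {h : Module.End K A}
    (hD : ∀ n : ℕ, HasDegree 𝒜 𝒜 (D n) (2 * n - 1)) (hh : HasDegree 𝒜 𝒜 h 1) (n : ℕ) :
    HasDegree 𝒜 𝒜 (coeff n (transferSeries D h)) (2 * n - 1) := by
  induction n using Nat.strong_induction_on with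
  | _ n ih =>
    rcases Nat.eq_zero_or_pos n with rfl | hn
    · rw [coeff_zero_transferSeries]
      exact HasDegree.zero _
    rw [transferSeries_eq, map_add, coeff_perturbationSeries D hn, coeff_mul]
    refine (hD n).add (HasDegree.sum ?_)
    rintro ⟨k, m⟩ hkm
    rw [Finset.HasAntidiagonal.mem_antidiagonal] at hkm
    simp only at hkm ⊢
    rcases Nat.eq_zero_or_pos k with rfl | hk
    · rw [coeff_mul_C, coeff_zero_perturbationSeries, zero_mul, zero_mul]
      exact HasDegree.zero _
    rw [coeff_mul_C, coeff_perturbationSeries D hk]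
    exact ((hD k).mul hh rfl).mul (ih m (by omega)) (by omega)

theorem hasDegree_coeff_one_add_transferSeries {D : ℕ → Module.End K A} {h : Module.End K A}
    (hD : ∀ n : ℕ, HasDegree 𝒜 𝒜 (D n) (2 * n - 1)) (hh : HasDegree 𝒜 𝒜 h 1) (n : ℕ) :
    HasDegree 𝒜 𝒜 (coeff n (1 + C h * transferSeries D h)) (2 * n + 0) := by
  rw [map_add, coeff_C_mul]
  refine HasDegree.add ?_ (hh.mul (hasDegree_coeff_transferSeries hD hh n) (by ring))
  rw [coeff_one]
  split_ifs with hn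
  · subst hn
    exact HasDegree.one
  · exact HasDegree.zero _

end Degree

/-- Unwinds the quotients, so that degeneration can be checked and used on representatives. -/
theorem FilteredComplex.pageDifferential_eq_zero_iff {K M : Type*} [Field K] [AddCommGroup M]
    [Module K M] (X : FilteredComplex K M) (r : ℕ) (p n : ℤ) :
    X.pageDifferential r p n = 0 ↔
      ∀ x ∈ X.cycles r p n, X.d x ∈ X.boundaries r (p + r) (n - 1) := by
  constructor
  · intro h x hx
    have h1 : X.pageDifferential r p n (Submodule.Quotient.mk ⟨x, hx⟩) = 0 := by
      rw [h, LinearMap.zero_apply]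
    have h2 := (Submodule.Quotient.mk_eq_zero _
      (x := (⟨X.d x, X.d_cycles r p n x hx⟩ : X.cycles r (p + r) (n - 1)))).1 h1
    exact h2
  · intro h
    refine LinearMap.ext fun x => ?_
    obtain ⟨⟨x, hx⟩, rfl⟩ := Submodule.Quotient.mk_surjective _ x
    exact (Submodule.Quotient.mk_eq_zero _).2 (h x hx)

/-! ### Degeneration and vanishing of the transferred operators -/

section Degeneration

open PowerSeries

variable {K A : Type*} [Field K] [AddCommGroup A] [Module K A] {𝒜 : ℤ → Submodule K A}

namespace HomotopyRetract

variable {d : A →ₗ[K] A} (R : HomotopyRetract 𝒜 d (homologyGrading 𝒜 d) 0)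

/-- The endomorphism `i p` of a homotopy retract. -/
def proj : Module.End K A := R.i ∘ₗ R.p

theorem proj_eq : R.proj = 1 + d * R.h + R.h * d := by
  have h := R.homotopy
  rw [sub_eq_iff_eq_add] at h
  rw [proj, h, add_comm, ← add_assoc]
  rfl

theorem d_i (x : Homology d) : d (R.i x) = 0 := by
  have h := LinearMap.congr_fun R.i_comm x
  simpa using h.symm

theorem p_d (x : A) : R.p (d x) = 0 := by
  simpa using LinearMap.congr_fun R.p_comm x

theorem d_mul_proj : d * R.proj = 0 := by
  ext x
  exact R.d_i _

theorem proj_mul_d : R.proj * d = 0 := by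
  ext x
  change R.i (R.p (d x)) = 0
  rw [R.p_d, map_zero]

/-- Uses injectivity of `i` in homology: the differential on the source is 0, so a class that is
trivial in its homology is already 0. -/
theorem i_mem_range {x : Homology d} {y : A} (h : d y = R.i x) : x = 0 := by
  have hx : x ∈ LinearMap.ker (0 : Homology d →ₗ[K] Homology d) := rfl
  have h1 : homologyMap R.i R.i_comm (Submodule.Quotient.mk ⟨x, hx⟩) =
      homologyMap R.i R.i_comm 0 := by
    rw [map_zero]
    exact (Submodule.Quotient.mk_eq_zero _).2 ⟨y, h⟩
  obtain ⟨w, hw⟩ := (Submodule.Quotient.mk_eq_zero _).1 (R.i_quasiIso.1 h1)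
  exact hw.symm

/-- In a homotopy retract onto the homology, `p` is a retraction of `i`. -/
theorem p_i (x : Homology d) : R.p (R.i x) = x := by
  refine sub_eq_zero.1 (R.i_mem_range (y := R.h (R.i x)) ?_)
  have h := LinearMap.congr_fun R.homotopy (R.i x)
  simp only [LinearMap.sub_apply, LinearMap.comp_apply, LinearMap.add_apply, LinearMap.id_apply,
    R.d_i, map_zero, add_zero] at h
  rw [map_sub, h]

end HomotopyRetract

namespace Multicomplex

variable (M : Multicomplex 𝒜) (R : M.HomologyRetract)

theorem transferred_eq {n : ℕ} (hn : 1 ≤ n) :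
    M.transferred R n = R.p ∘ₗ coeff n (transferSeries M.Δ R.h) ∘ₗ R.i := by
  rw [transferred, coeff_transferSeries _ _ hn]
  ext x
  simp

theorem C_proj : C R.proj =
    (1 + C (M.Δ 0) * C R.h + C R.h * C (M.Δ 0) : (Module.End K A)⟦X⟧) := by
  rw [R.proj_eq]
  simp

/-- The factor e on the right of 1 + ha gives the perturbed inclusion followed after p. Since de =
0, the perturbed differential d + ea reduces to ea on the image of e. -/
theorem mk_mul_inclusion :
    PowerSeries.mk M.Δ * ((1 + C R.h * transferSeries M.Δ R.h) * C R.proj) =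
      (1 + C R.h * transferSeries M.Δ R.h) * (C R.proj * transferSeries M.Δ R.h * C R.proj) := by
  have h : C (M.Δ 0) * C R.proj = 0 := by rw [← map_mul, R.d_mul_proj, map_zero]
  rw [← mul_assoc, mk_mul_one_add_transferSeries R.h M.mk_mul_mk, ← M.C_proj R, mul_assoc,
    add_mul (C (M.Δ 0)), h, zero_add]

theorem projection_mul_mk :
    C R.proj * (1 + transferSeries M.Δ R.h * C R.h) * PowerSeries.mk M.Δ =
      C R.proj * transferSeries M.Δ R.h * C R.proj * (1 + transferSeries M.Δ R.h * C R.h) := by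
  have h : C R.proj * C (M.Δ 0) = 0 := by rw [← map_mul, R.proj_mul_d, map_zero]
  rw [mul_assoc, one_add_transferSeries_mul_mk R.h M.mk_mul_mk, ← M.C_proj R, ← mul_assoc,
    mul_add _ (C (M.Δ 0)), h, zero_add, ← mul_assoc]

theorem degeneratesAtFirstPage_of_transferred_eq_zero
    (hR : ∀ n : ℕ, 1 ≤ n → M.transferred R n = 0) : M.totalComplex.DegeneratesAtFirstPage := by
  set a : (Module.End K A)⟦X⟧ := transferSeries M.Δ R.h with ha
  -- The n-th coefficient is iΔ'_n p.
  have heae : C R.proj * a * C R.proj = 0 := by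
    ext1 n
    rw [coeff_mul_C, coeff_C_mul, map_zero]
    rcases Nat.eq_zero_or_pos n with rfl | hn
    · rw [ha, coeff_zero_transferSeries, mul_zero, zero_mul]
    · have h := hR n hn
      rw [M.transferred_eq R hn] at h
      ext x
      have hx := LinearMap.congr_fun h (R.p x)
      exact (congrArg R.i hx).trans (map_zero _)
  have hcyc : PowerSeries.mk M.Δ * ((1 + C R.h * a) * C R.proj) = 0 := by
    rw [ha, M.mk_mul_inclusion R, ← ha, heae, mul_zero]
  intro r hr p n
  refine (M.totalComplex.pageDifferential_eq_zero_iff r p n).2 ?_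
  rintro x ⟨⟨hxn, hxp⟩, hdx⟩
  change x ∈ totalDegree 𝒜 n at hxn
  change x ∈ rowFiltration K A p at hxp
  change M.totalDifferential x ∈ rowFiltration K A (p + r) at hdx
  change M.totalDifferential x ∈ M.totalComplex.boundaries r (p + r) (n - 1)
  set c := x.1 (-p) with hc
  have hcdeg : c ∈ 𝒜 (n - -p - -p) := hxn (-p) (Set.mem_univ _)
  -- Since r ≥ 1, ∂x has no entry in row -p, and that entry is d applied to the leading entry of x.
  have hdc : M.Δ 0 c = 0 := by
    have h := rowOperator_apply_leading_self (PowerSeries.mk M.Δ) hxp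
    rw [← M.totalDifferential_eq_rowOperator, hdx _ (by omega), coeff_mk] at h
    exact h.symm
  have hec : R.proj c = c + M.Δ 0 (R.h c) := by
    rw [R.proj_eq]
    simp [hdc]
  -- The ∂-cycle u has leading entry ec = c + dhc; the boundary ∂v corrects the excess dhc. Thus x -
  -- u + ∂v loses its entry in row -p.
  set u := rowOperator ((1 + C R.h * a) * C R.proj) (rowSingle K (-p) c) with hu
  set v := rowSingle K (-p) (R.h c) with hv
  have hufil : u ∈ rowFiltration K A p :=
    rowOperator_mem_rowFiltration_self _ (rowSingle_mem_rowFiltration p c)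
  have hvfil : v ∈ rowFiltration K A p := rowSingle_mem_rowFiltration p _
  have hu0 : u.1 (-p) = R.proj c := by
    rw [hu, rowOperator_apply_leading_self _ (rowSingle_mem_rowFiltration p c),
      rowSingle_apply_self, coeff_mul_C, map_add, coeff_C_mul, ha, coeff_zero_transferSeries]
    simp
  have hv0 : (M.totalDifferential v).1 (-p) = M.Δ 0 (R.h c) := by
    rw [M.totalDifferential_eq_rowOperator, rowOperator_apply_leading_self _ hvfil, coeff_mk, hv,
      rowSingle_apply_self]
  have hdu : M.totalDifferential u = 0 := by
    rw [M.totalDifferential_eq_rowOperator, hu, ← rowOperator_mul_apply, hcyc, rowOperator_zero,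
      LinearMap.zero_apply]
  have hdz : M.totalDifferential (x - u + M.totalDifferential v) = M.totalDifferential x := by
    rw [map_add, map_sub, hdu, M.totalDifferential_sq, sub_zero, add_zero]
  have hudeg : u ∈ totalDegree 𝒜 n := by
    have hdeg : ∀ r : ℕ, HasDegree 𝒜 𝒜 (coeff r ((1 + C R.h * a) * C R.proj)) (2 * r + 0) :=
      fun r => by
        rw [coeff_mul_C]
        exact (hasDegree_coeff_one_add_transferSeries M.degree R.h_degree r).mul
          (R.i_degree.comp R.p_degree rfl) (by ring)
    simpa using rowOperator_mem_totalDegree hdeg (rowSingle_mem_totalDegree hcdeg)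
  have hvdeg : v ∈ totalDegree 𝒜 (n + 1) := by
    refine rowSingle_mem_totalDegree ?_
    have h := R.h_degree _ _ hcdeg
    rwa [show n - -p - -p + 1 = n + 1 - -p - -p by ring] at h
  have hdvdeg : M.totalDifferential v ∈ totalDegree 𝒜 n := by
    have h : M.totalDifferential v ∈ totalDegree 𝒜 (n + 1 - 1) := M.totalComplex.d_deg _ _ hvdeg
    rwa [add_sub_cancel_right] at h
  have hdvfil : M.totalDifferential v ∈ rowFiltration K A p := M.totalComplex.d_fil p v hvfil
  -- The denominator at filtration p + r allows boundaries from step (p + r) - r + 1 = p + 1, which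
  -- is where the corrected element lies.
  refine Submodule.mem_sup_right
    ⟨hdx, x - u + M.totalDifferential v, ⟨?_, ?_⟩, hdz⟩
  · change _ ∈ totalDegree 𝒜 _
    rw [sub_add_cancel]
    exact add_mem (sub_mem hxn hudeg) hdvdeg
  · change _ ∈ rowFiltration K A _
    intro q hq
    rcases eq_or_ne q (-p) with rfl | hne
    · change x.1 (-p) - u.1 (-p) + (M.totalDifferential v).1 (-p) = 0
      rw [hu0, hv0, hec, ← hc]
      abel
    · have hq' : -p < q := by omega
      change x.1 q - u.1 q + (M.totalDifferential v).1 q = 0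
      rw [hxp q hq', hufil q hq', hdvfil q hq', sub_zero, add_zero]

/-- The lowest nonvanishing coefficient of the transferred differential obstructs degeneration. -/
theorem coeff_proj_mul_transferSeries_mul_proj_apply
    (hM : M.totalComplex.DegeneratesAtFirstPage) {n : ℕ} (hn : 1 ≤ n)
    (hlow : ∀ k < n, coeff k (C R.proj * transferSeries M.Δ R.h * C R.proj) = 0)
    {j : ℤ} {c : A} (hc : c ∈ 𝒜 j) :
    coeff n (C R.proj * transferSeries M.Δ R.h * C R.proj) c = 0 := by
  set a : (Module.End K A)⟦X⟧ := transferSeries M.Δ R.h with ha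
  set B := C R.proj * a * C R.proj with hB
  have hI : PowerSeries.mk M.Δ * ((1 + C R.h * a) * C R.proj) = (1 + C R.h * a) * B :=
    M.mk_mul_inclusion R
  have hJ : C R.proj * (1 + a * C R.h) * PowerSeries.mk M.Δ = B * (1 + a * C R.h) :=
    M.projection_mul_mk R
  have ha0 : coeff 0 a = 0 := by rw [ha, coeff_zero_transferSeries]
  have hI0 : coeff 0 (1 + C R.h * a) = 1 := by
    rw [map_add, coeff_C_mul, ha0, mul_zero, add_zero, coeff_zero_one]
  -- The projection is tested through e, which fixes the values of the coefficient in question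
  -- because pi = 1.
  have hJ0 : coeff 0 (C R.proj * (1 + a * C R.h)) = R.proj := by
    rw [coeff_C_mul, map_add, coeff_mul_C, ha0, zero_mul, add_zero, coeff_zero_one, mul_one]
  have hBn : R.proj (coeff n B c) = coeff n B c := by
    rw [hB, coeff_mul_C, coeff_C_mul]
    change R.i (R.p (R.i (R.p _))) = R.i (R.p _)
    rw [R.p_i]
  set y := rowSingle K (-0) c with hy
  have hyfil : y ∈ rowFiltration K A 0 := rowSingle_mem_rowFiltration 0 c
  set x := rowOperator ((1 + C R.h * a) * C R.proj) y with hx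
  have hByfil : rowOperator B y ∈ rowFiltration K A (0 + n) :=
    rowOperator_mem_rowFiltration hlow hyfil
  have hdx : M.totalDifferential x = rowOperator (1 + C R.h * a) (rowOperator B y) := by
    rw [M.totalDifferential_eq_rowOperator, hx, ← rowOperator_mul_apply, hI,
      rowOperator_mul_apply]
  have hdxfil : M.totalDifferential x ∈ rowFiltration K A (0 + n) := by
    rw [hdx]
    exact rowOperator_mem_rowFiltration_self _ hByfil
  have hxdeg : x ∈ totalDegree 𝒜 j := by
    have hdeg : ∀ r : ℕ, HasDegree 𝒜 𝒜 (coeff r ((1 + C R.h * a) * C R.proj)) (2 * r + 0) :=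
      fun r => by
        rw [coeff_mul_C]
        exact (hasDegree_coeff_one_add_transferSeries M.degree R.h_degree r).mul
          (R.i_degree.comp R.p_degree rfl) (by ring)
    have hydeg : y ∈ totalDegree 𝒜 j := rowSingle_mem_totalDegree (by simpa using hc)
    simpa using rowOperator_mem_totalDegree hdeg hydeg
  have hxcyc : x ∈ M.totalComplex.cycles n 0 j :=
    ⟨⟨hxdeg, rowOperator_mem_rowFiltration_self _ hyfil⟩, hdxfil⟩
  have hbd : M.totalDifferential x ∈ M.totalComplex.boundaries n (0 + n) (j - 1) :=
    (M.totalComplex.pageDifferential_eq_zero_iff n 0 j).1 (hM n hn 0 j) x hxcyc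
  obtain ⟨b, ⟨⟨-, hb⟩, -⟩, w, ⟨-, z, ⟨-, hz⟩, rfl⟩, hbz⟩ := Submodule.mem_sup.1 hbd
  change b ∈ rowFiltration K A (0 + n + 1) at hb
  change z ∈ rowFiltration K A (0 + n - n + 1) at hz
  change b + M.totalDifferential z = M.totalDifferential x at hbz
  -- Apply e(1 + ah) and read row -n. The term b lies too deep to contribute; ∂z becomes eae(1 +
  -- ah)z, which starts at step n + 1 because z starts at step 1 and eae has order at least n. Only
  -- the coefficient applied to c survives.
  have key := congrArg (fun u => (rowOperator (C R.proj * (1 + a * C R.h)) u).1 (-(0 + n))) hbz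
  simp only [map_add] at key
  have h1 : (rowOperator (C R.proj * (1 + a * C R.h)) b).1 (-(0 + n)) = 0 :=
    rowOperator_mem_rowFiltration_self _ hb _ (by omega)
  have h2 : (rowOperator (C R.proj * (1 + a * C R.h)) (M.totalDifferential z)).1 (-(0 + n)) =
      0 := by
    rw [M.totalDifferential_eq_rowOperator, ← rowOperator_mul_apply, hJ, rowOperator_mul_apply]
    exact rowOperator_mem_rowFiltration hlow (rowOperator_mem_rowFiltration_self _ hz) _
      (by omega)
  have h3 : (rowOperator (C R.proj * (1 + a * C R.h)) (M.totalDifferential x)).1 (-(0 + n)) =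
      coeff n B c := by
    rw [rowOperator_apply_leading_self _ hdxfil, hdx, rowOperator_apply_leading_self _ hByfil,
      rowOperator_apply_leading hlow hyfil _ rfl, hI0, hJ0, hy, rowSingle_apply_self,
      Module.End.one_apply, hBn]
  rw [← h3, ← key, Submodule.coe_add, Pi.add_apply, h1, h2, add_zero]

theorem transferred_eq_zero_of_degeneratesAtFirstPage (h𝒜 : DirectSum.IsInternal 𝒜)
    (hM : M.totalComplex.DegeneratesAtFirstPage) (n : ℕ) (hn : 1 ≤ n) :
    M.transferred R n = 0 := by
  have hB : coeff n (C R.proj * transferSeries M.Δ R.h * C R.proj) = 0 := by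
    -- Positivity is dropped so that the induction hypothesis covers all lower coefficients,
    -- including the constant one.
    clear hn
    induction n using Nat.strong_induction_on with
    | _ n ih =>
      rcases Nat.eq_zero_or_pos n with rfl | hn
      · rw [coeff_mul_C, coeff_C_mul, coeff_zero_transferSeries, mul_zero, zero_mul]
      refine LinearMap.ker_eq_top.1 (top_le_iff.1 ?_)
      rw [← h𝒜.submodule_iSup_eq_top]
      exact iSup_le fun j c hc =>
        M.coeff_proj_mul_transferSeries_mul_proj_apply R hM hn ih hc
  rw [coeff_mul_C, coeff_C_mul] at hB
  rw [M.transferred_eq R hn]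
  refine LinearMap.ext fun x => ?_
  have h := congrArg R.p (LinearMap.congr_fun hB (R.i x))
  change R.p (R.i (R.p _)) = R.p 0 at h
  rw [R.p_i, map_zero] at h
  change R.p (coeff n (transferSeries M.Δ R.h) (R.i (R.p (R.i x)))) = 0 at h
  rwa [R.p_i] at h

end Multicomplex

end Degeneration

/-! ### Existence of homotopy retracts onto the homology -/

section Existence

variable {K A : Type*} [Field K] [AddCommGroup A] [Module K A] {𝒜 : ℤ → Submodule K A}

/-- Every operator on a vector space has a generalized inverse. -/
theorem LinearMap.exists_generalizedInverse (d : Module.End K A) :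
    ∃ g : Module.End K A, d * g * d = d := by
  obtain ⟨s, hs⟩ := d.rangeRestrict.exists_rightInverse_of_surjective d.range_rangeRestrict
  obtain ⟨t, ht⟩ := (LinearMap.range d).subtype.exists_leftInverse_of_injective
    (Submodule.ker_subtype _)
  refine ⟨s ∘ₗ t, LinearMap.ext fun x => ?_⟩
  have h1 : t (d x) = d.rangeRestrict x := LinearMap.congr_fun ht (d.rangeRestrict x)
  have h2 : d.rangeRestrict (s (d.rangeRestrict x)) = d.rangeRestrict x :=
    LinearMap.congr_fun hs (d.rangeRestrict x)
  change d (s (t (d x))) = d x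
  rw [h1]
  exact congrArg Subtype.val h2

/-- The component of degree `k` of an operator on a graded vector space. -/
theorem exists_hasDegree_component (h𝒜 : DirectSum.IsInternal 𝒜) (g : Module.End K A) (k : ℤ) :
    ∃ g' : Module.End K A, HasDegree 𝒜 𝒜 g' k ∧
      ∀ (e : Module.End K A) (l : ℤ), HasDegree 𝒜 𝒜 e l → ∀ (j : ℤ) (x : A), x ∈ 𝒜 j →
        e (g x) ∈ 𝒜 (j + k + l) → e (g' x) = e (g x) := by
  classical
  let := h𝒜.chooseDecomposition
  let π : ℤ → Module.End K A := fun j =>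
    (𝒜 j).subtype ∘ₗ DirectSum.component K ℤ (fun i => 𝒜 i) j ∘ₗ
      (DirectSum.decomposeLinearEquiv 𝒜).toLinearMap
  have hπ : ∀ j x, π j x = (DirectSum.decompose 𝒜 x j : A) := fun _ _ => rfl
  let G : Module.End K A :=
    DirectSum.toModule K ℤ A (fun j => π (j + k) ∘ₗ g ∘ₗ (𝒜 j).subtype) ∘ₗ
      (DirectSum.decomposeLinearEquiv 𝒜).toLinearMap
  have hG : ∀ (j : ℤ) (x : A), x ∈ 𝒜 j → G x = π (j + k) (g x) := fun j x hx => by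
    change DirectSum.toModule K ℤ A _ (DirectSum.decompose 𝒜 x) = _
    rw [DirectSum.decompose_of_mem 𝒜 hx, ← DirectSum.lof_eq_of K, DirectSum.toModule_lof]
    rfl
  -- Homogeneous operators intertwine the projections onto graded pieces. Hence `e` cannot
  -- distinguish g' from g when e(g x) already lies in the expected degree.
  have hcomm : ∀ (e : Module.End K A) (l : ℤ), HasDegree 𝒜 𝒜 e l → ∀ (j : ℤ) (y : A),
      e (π j y) = π (j + l) (e y) := by
    intro e l he j y
    induction y using DirectSum.Decomposition.inductionOn 𝒜 with
    | zero => simp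
    | @homogeneous i m =>
      have hm := he i m m.2
      by_cases hij : i = j
      · subst hij
        rw [hπ, hπ, DirectSum.decompose_of_mem_same 𝒜 m.2, DirectSum.decompose_of_mem_same 𝒜 hm]
      · rw [hπ, hπ, DirectSum.decompose_of_mem_ne 𝒜 m.2 hij,
          DirectSum.decompose_of_mem_ne 𝒜 hm (by omega), map_zero]
    | add y z hy hz => simp only [map_add, hy, hz]
  refine ⟨G, fun j x hx => ?_, fun e l he j x hx h => ?_⟩
  · rw [hG j x hx, hπ]
    exact SetLike.coe_mem _
  · rw [hG j x hx, hcomm e l he, hπ, DirectSum.decompose_of_mem_same 𝒜 h]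

/-- The sign matches the convention ip - 1 = dh + hd: it makes 1 + dh + hd vanish on boundaries.
Homogeneity comes from taking the degree 1 part of minus a generalized inverse. -/
theorem exists_contraction (h𝒜 : DirectSum.IsInternal 𝒜) {d : Module.End K A}
    (hd : HasDegree 𝒜 𝒜 d (-1)) :
    ∃ h : Module.End K A, HasDegree 𝒜 𝒜 h 1 ∧ d * h * d = -d := by
  obtain ⟨g, hg⟩ := LinearMap.exists_generalizedInverse d
  obtain ⟨g', hg', hdg⟩ := exists_hasDegree_component h𝒜 (-g) 1
  refine ⟨g', hg', ?_⟩
  rw [← sub_eq_zero]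
  refine LinearMap.ker_eq_top.1 (top_le_iff.1 ?_)
  rw [← h𝒜.submodule_iSup_eq_top]
  refine iSup_le fun j x hx => ?_
  have hgx : d ((-g) (d x)) = -d x := by
    rw [LinearMap.neg_apply, map_neg]
    exact congrArg Neg.neg (LinearMap.congr_fun hg x)
  have hdx := hd j x hx
  have h := hdg d (-1) hd (j + -1) (d x) hdx (by
    rw [hgx, add_neg_cancel_right]
    exact neg_mem hdx)
  rw [hgx] at h
  change d (g' (d x)) - -d x = 0
  rw [h, sub_self]

/-- The second condition is what makes e = 1 + dh + hd idempotent. Adding dgg leaves dg unchanged,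
as d² = 0, and cancels dggd because dgd = -d. -/
theorem exists_special_contraction (h𝒜 : DirectSum.IsInternal 𝒜) {d : Module.End K A}
    (hd : HasDegree 𝒜 𝒜 d (-1)) (hdd : d * d = 0) :
    ∃ h : Module.End K A, HasDegree 𝒜 𝒜 h 1 ∧ d * h * d = -d ∧ d * h * h * d = 0 := by
  obtain ⟨g, hg, hdg⟩ := exists_contraction h𝒜 hd
  have h1 : d * (g + d * g * g) = d * g := by
    rw [mul_add, mul_assoc d g g, ← mul_assoc d d, hdd, zero_mul, add_zero]
  refine ⟨g + d * g * g, hg.add ((hd.mul hg rfl).mul hg (by ring)), ?_, ?_⟩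
  · rw [h1, hdg]
  · rw [h1]
    calc d * g * (g + d * g * g) * d = d * g * g * d + (d * g * d) * g * g * d := by noncomm_ring
      _ = 0 := by rw [hdg]; noncomm_ring

/-- The idempotent e has values in cycles, kills boundaries and moves a cycle z by the boundary dhz.
So x ↦ [ex] and [z] ↦ ez are well defined, and their composite on A is e² = e. -/
theorem nonempty_homotopyRetract_homology (h𝒜 : DirectSum.IsInternal 𝒜) {d : Module.End K A}
    (hd : HasDegree 𝒜 𝒜 d (-1)) (hdd : d * d = 0) :
    Nonempty (HomotopyRetract 𝒜 d (homologyGrading 𝒜 d) 0) := by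
  obtain ⟨h, hh, hdhd, hdhhd⟩ := exists_special_contraction h𝒜 hd hdd
  obtain ⟨e, he⟩ : ∃ e : Module.End K A, e = 1 + d * h + h * d := ⟨_, rfl⟩
  have hde : d * e = 0 := by
    rw [he, mul_add, mul_add, mul_one, ← mul_assoc d d, hdd, zero_mul, add_zero, ← mul_assoc,
      hdhd, add_neg_cancel]
  have hed : e * d = 0 := by
    rw [he, add_mul, add_mul, one_mul, mul_assoc h d d, hdd, mul_zero, add_zero, hdhd,
      add_neg_cancel]
  have hee : e * e = e := by
    have h1 : e * h * d = 0 := by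
      rw [he]
      calc (1 + d * h + h * d) * h * d = h * d + d * h * h * d + h * (d * h * d) := by
            noncomm_ring
        _ = 0 := by rw [hdhd, hdhhd]; noncomm_ring
    calc e * e = e * (1 + d * h + h * d) := by rw [← he]
      _ = e + e * d * h + e * h * d := by noncomm_ring
      _ = e := by rw [hed, h1, zero_mul, add_zero, add_zero]
  have hdeg : HasDegree 𝒜 𝒜 e 0 := by
    rw [he]
    exact (HasDegree.one.add (hd.mul hh (by ring))).add (hh.mul hd (by ring))
  have hde' : ∀ x, d (e x) = 0 := LinearMap.congr_fun hde
  have hed' : ∀ x, e (d x) = 0 := LinearMap.congr_fun hed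
  have hez : ∀ z, d z = 0 → e z = z + d (h z) := fun z hz => by
    rw [he]
    simp [hz]
  let B := (LinearMap.range d).submoduleOf (LinearMap.ker d)
  let i : Homology d →ₗ[K] A := B.liftQ (e ∘ₗ (LinearMap.ker d).subtype) (by
    rintro ⟨z, hz⟩ ⟨y, hy⟩
    change d y = z at hy
    change e z = 0
    rw [← hy, hed'])
  let p : A →ₗ[K] Homology d := B.mkQ ∘ₗ e.codRestrict (LinearMap.ker d) hde'
  have hi : ∀ z : LinearMap.ker d, i (Submodule.Quotient.mk z) = e z := fun _ => rfl
  have hp : ∀ x, p x = Submodule.Quotient.mk ⟨e x, hde' x⟩ := fun _ => rfl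
  have hi_comm : i ∘ₗ (0 : Homology d →ₗ[K] Homology d) = d ∘ₗ i := by
    refine LinearMap.ext fun y => ?_
    obtain ⟨z, rfl⟩ := Submodule.Quotient.mk_surjective _ y
    change i 0 = d (i _)
    rw [hi, hde', map_zero]
  refine ⟨⟨p, i, h, ?_, ?_, hh, ?_, hi_comm, ⟨?_, ?_⟩, ?_⟩⟩
  · intro j x hx
    exact ⟨⟨e x, hde' x⟩, hdeg j x hx, rfl⟩
  · rintro j _ ⟨z, hz, rfl⟩
    exact hdeg j z hz
  · refine LinearMap.ext fun x => ?_
    change p (d x) = 0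
    rw [hp]
    exact (Submodule.Quotient.mk_eq_zero _).2 ⟨0, by simp [hed']⟩
  · rw [injective_iff_map_eq_zero]
    intro y hy
    -- The source is the homology of (H, 0), so a representative has to be chosen twice.
    obtain ⟨⟨y, hy0⟩, rfl⟩ := Submodule.Quotient.mk_surjective _ y
    obtain ⟨⟨z, hz⟩, rfl⟩ := Submodule.Quotient.mk_surjective _ y
    obtain ⟨w, hw⟩ := (Submodule.Quotient.mk_eq_zero _).1 hy
    change d w = e z at hw
    rw [hez z hz] at hw
    refine (Submodule.Quotient.mk_eq_zero _).2 ⟨0, ?_⟩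
    rw [map_zero]
    symm
    refine (Submodule.Quotient.mk_eq_zero _).2 ⟨w - h z, ?_⟩
    rw [map_sub, hw]
    exact add_sub_cancel_right _ _
  · intro y
    obtain ⟨⟨z, hz⟩, rfl⟩ := Submodule.Quotient.mk_surjective _ y
    refine ⟨Submodule.Quotient.mk ⟨Submodule.Quotient.mk ⟨z, hz⟩, rfl⟩, ?_⟩
    refine (Submodule.Quotient.eq _).2 ⟨h z, ?_⟩
    change d (h z) = e z - z
    rw [hez z hz, add_sub_cancel_left]
  · refine LinearMap.ext fun x => ?_
    change e (e x) - x = d (h x) + h (d x)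
    rw [show e (e x) = e x from LinearMap.congr_fun hee x, he]
    change x + d (h x) + h (d x) - x = _
    abel

theorem Multicomplex.nonempty_homologyRetract (h𝒜 : DirectSum.IsInternal 𝒜)
    (M : Multicomplex 𝒜) : Nonempty M.HomologyRetract := by
  refine nonempty_homotopyRetract_homology h𝒜 (by simpa using M.degree 0) ?_
  have h : M.Δ 0 ∘ₗ M.Δ 0 = 0 := by simpa using M.relation 0
  exact h

end Existence

/-! ### The two equivalences -/

theorem mainTheorem6 {K A : Type*} [Field K] [CharZero K] [AddCommGroup A] [Module K A]
    (𝒜 : ℤ → Submodule K A) (h𝒜 : DirectSum.IsInternal 𝒜) (M : Multicomplex 𝒜) :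
    (M.totalComplex.DegeneratesAtFirstPage ↔ Nonempty M.DegenerationData) ∧
    (∀ R : M.HomologyRetract,
      M.totalComplex.DegeneratesAtFirstPage ↔ ∀ n : ℕ, 1 ≤ n → M.transferred R n = 0) := by
  have key : ∀ R : M.HomologyRetract,
      M.totalComplex.DegeneratesAtFirstPage ↔ ∀ n : ℕ, 1 ≤ n → M.transferred R n = 0 := fun R =>
    ⟨M.transferred_eq_zero_of_degeneratesAtFirstPage R h𝒜,
      M.degeneratesAtFirstPage_of_transferred_eq_zero R⟩
  refine ⟨⟨fun h => ?_, fun ⟨D⟩ => (key D.retract).2 D.vanishing⟩, key⟩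
  obtain ⟨R⟩ := M.nonempty_homologyRetract h𝒜
  exact ⟨⟨R, (key R).1 h⟩⟩
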